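/- Let $k\ge 2$ be an integer and let $q$ be a complex number with $|q|<1$. Write $(a;q)_n=\prod_{j=0}^{n-1}(1-aq^j)$ and $(a;q)_\infty=\prod_{j=0}^{\infty}(1-aq^j)$. Then $$\sum_{N_1\ge N_2\ge\cdots\ge N_{k-1}\ge 0}\frac{q^{N_1(N_1+1)/2+N_2^2+\cdots+N_{k-1}^2+N_2+\cdots+N_{k-1}}\,(-q;q)_{N_1}}{(q;q)_{N_1-N_2}\cdots(q;q)_{N_{k-2}-N_{k-1}}\,(q;q)_{N_{k-1}}\,(-q;q)_{N_{k-1}}}=\frac{(-q;q)_\infty\,(q;q^{2k-1})_\infty\,(q^{2k-2};q^{2k-1})_\infty\,(q^{2k-1};q^{2k-1})_\infty}{(q;q)_\infty},$$ where the sum runs over all integer sequences $N_1\ge N_2\ge\cdots\ge N_{k-1}\ge 0$ and converges absolutely. -/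

import Mathlib

/-- The finite `q`-shifted factorial `(a; q)_n = ∏_{j=0}^{n-1} (1 - a q^j)`. -/
noncomputable def qPoch (a q : ℂ) (n : ℕ) : ℂ :=
  ∏ j ∈ Finset.range n, (1 - a * q ^ j)

/-- The infinite `q`-shifted factorial `(a; q)_∞ = ∏_{j=0}^∞ (1 - a q^j)`, for `|q| < 1`. -/
noncomputable def qPochInf (a q : ℂ) : ℂ :=
  ∏' j : ℕ, (1 - a * q ^ j)

/-- The product defining `(a; q)_∞` converges for `|q| < 1`. -/
theorem multipliable_qPochInf (a : ℂ) {q : ℂ} (hq : ‖q‖ < 1) :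
    Multipliable fun j : ℕ => 1 - a * q ^ j := by
  have h : Summable fun j : ℕ => ‖-(a * q ^ j)‖ := by
    simpa [norm_mul, norm_pow] using
      (summable_geometric_of_lt_one (norm_nonneg q) hq).mul_left ‖a‖
  simpa [sub_eq_add_neg] using multipliable_one_add_of_summable h

/-- The sequences `N_1 ≥ N_2 ≥ ⋯ ≥ N_r ≥ 0` of integers. -/
abbrev DecSeq (r : ℕ) : Type := {N : Fin r → ℕ // Antitone N}

/-- The entry `N_i` of a sequence, with `1 ≤ i ≤ r`; all other values are `0` (and not used). -/
def DecSeq.entry {r : ℕ} (N : DecSeq r) (i : ℕ) : ℕ :=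
  if h : 1 ≤ i ∧ i ≤ r then N.1 ⟨i - 1, by omega⟩ else 0

/-- The general term of the multisum, for `N_1 ≥ ⋯ ≥ N_{k-1} ≥ 0`:
`q^{N_1(N_1+1)/2 + N_2^2 + ⋯ + N_{k-1}^2 + N_2 + ⋯ + N_{k-1}} (-q; q)_{N_1}` divided by
`(q; q)_{N_1-N_2} ⋯ (q; q)_{N_{k-2}-N_{k-1}} (q; q)_{N_{k-1}} (-q; q)_{N_{k-1}}`. -/
noncomputable def multisumTerm (k : ℕ) (q : ℂ) (N : DecSeq (k - 1)) : ℂ :=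
  q ^ (N.entry 1 * (N.entry 1 + 1) / 2
        + ∑ i ∈ Finset.Icc 2 (k - 1), N.entry i ^ 2 + ∑ i ∈ Finset.Icc 2 (k - 1), N.entry i)
      * qPoch (-q) q (N.entry 1)
    / ((∏ i ∈ Finset.Icc 1 (k - 2), qPoch q q (N.entry i - N.entry (i + 1)))
        * qPoch q q (N.entry (k - 1)) * qPoch (-q) q (N.entry (k - 1)))

open Finset Filter Topology

/-! This is a Bailey chain relative to `q`. The innermost factor 1/((q;q)_N (-q;q)_N) is the β of a
Bailey pair with α_r proportional to (-1)^r q^(r²) (1 - q^(2r+1)) (`sum_bailey_pair_base`). Each sum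
over N_{k-1}, ..., N_2 is a Bailey step with both parameters sent to infinity; it multiplies α_r by
q^(r²+r) (`baileyBeta_eq_sum`, from `sum_qVandermonde`). The outer sum over N_1 is a Bailey step
with parameters -q and ∞. Exchanging sums leaves, for each r, an inner series whose value
(-q;q)_∞/(q;q)_∞ does not depend on r (`hasSum_phiTerm`). What remains is ∑ q^(r(r+1)/2) α_r, a
Jacobi triple product with base q^(2k-1) (`hasSum_triple_product`). -/

theorem qPoch_zero (a q : ℂ) : qPoch a q 0 = 1 := by simp [qPoch]

theorem qPoch_succ (a q : ℂ) (n : ℕ) : qPoch a q (n + 1) = qPoch a q n * (1 - a * q ^ n) := by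
  simp [qPoch, Finset.prod_range_succ]

theorem qPoch_self_succ (q : ℂ) (n : ℕ) :
    qPoch q q (n + 1) = qPoch q q n * (1 - q ^ (n + 1)) := by
  rw [qPoch_succ, pow_succ']

theorem qPoch_neg_self_succ (q : ℂ) (n : ℕ) :
    qPoch (-q) q (n + 1) = qPoch (-q) q n * (1 + q ^ (n + 1)) := by
  rw [qPoch_succ]; ring

theorem one_sub_mul_pow_ne_zero {a q : ℂ} (ha : ‖a‖ < 1) (hq : ‖q‖ < 1) (n : ℕ) :
    1 - a * q ^ n ≠ 0 := by
  intro h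
  have h1 : ‖a * q ^ n‖ = 1 := by rw [← sub_eq_zero.mp h]; simp
  rw [norm_mul, norm_pow] at h1
  have := pow_le_one₀ (n := n) (norm_nonneg q) hq.le
  nlinarith [norm_nonneg a]

theorem one_sub_pow_succ_ne_zero {q : ℂ} (hq : ‖q‖ < 1) (n : ℕ) : 1 - q ^ (n + 1) ≠ 0 := by
  rw [pow_succ']; exact one_sub_mul_pow_ne_zero hq hq n

theorem one_add_pow_succ_ne_zero {q : ℂ} (hq : ‖q‖ < 1) (n : ℕ) : 1 + q ^ (n + 1) ≠ 0 := by
  have := one_sub_mul_pow_ne_zero (a := -q) (by simpa using hq) hq n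
  rwa [neg_mul, sub_neg_eq_add, ← pow_succ'] at this

theorem qPoch_ne_zero {a q : ℂ} (ha : ‖a‖ < 1) (hq : ‖q‖ < 1) (n : ℕ) : qPoch a q n ≠ 0 :=
  Finset.prod_ne_zero_iff.mpr fun j _ => one_sub_mul_pow_ne_zero ha hq j

/-! ### Finite identities by creative telescoping -/

/-- Creative telescoping for sums `∑_{r ≤ n}` whose range grows with `n`. -/
theorem mul_sum_range_eq_of_telescope {F F' G : ℕ → ℂ} {c d : ℂ} (n : ℕ) (h0 : G 0 = 0)
    (hstep : ∀ r s, r + s = n → c * F' r - d * F r = G (r + 1) - G r)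
    (hlast : c * F' (n + 1) + G (n + 1) = 0) :
    c * ∑ r ∈ range (n + 2), F' r = d * ∑ r ∈ range (n + 1), F r := by
  have h : ∑ r ∈ range (n + 1), (c * F' r - d * F r) = G (n + 1) - G 0 := by
    -- Writing n = r + s in `hstep` removes truncated subtraction from the certificate checks.
    rw [← Finset.sum_range_sub]
    refine Finset.sum_congr rfl fun r hr => hstep r (n - r) ?_
    have := Finset.mem_range.mp hr
    omega
  rw [Finset.sum_sub_distrib, ← Finset.mul_sum, ← Finset.mul_sum] at h
  rw [Finset.sum_range_succ]
  linear_combination h + hlast - h0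

/-- The Bailey pair relative to `q` with `β_L = 1 / (q²; q²)_L`. -/
theorem sum_bailey_pair_base {q : ℂ} (hq : ‖q‖ < 1) (L : ℕ) :
    ∑ r ∈ range (L + 1), (-1) ^ r * q ^ (r ^ 2) * (1 - q ^ (2 * r + 1))
        / (qPoch q q (L - r) * qPoch q q (L + r + 1))
      = 1 / (qPoch q q L * qPoch (-q) q L) := by
  have hP := qPoch_ne_zero hq hq
  have hM := qPoch_ne_zero (a := -q) (by simpa using hq) hq
  have h1 := one_sub_pow_succ_ne_zero hq
  have h2 := one_add_pow_succ_ne_zero hq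
  induction L with
  | zero => simpa [qPoch] using h1 0
  | succ n ih =>
    -- The ratio d/c is that of consecutive right-hand sides; `G` is the telescoping certificate.
    have key := mul_sum_range_eq_of_telescope (c := 1 - q ^ (2 * n + 2)) (d := 1)
      (F' := fun r => (-1) ^ r * q ^ (r ^ 2) * (1 - q ^ (2 * r + 1))
        / (qPoch q q (n + 1 - r) * qPoch q q (n + 1 + r + 1)))
      (F := fun r => (-1) ^ r * q ^ (r ^ 2) * (1 - q ^ (2 * r + 1))
        / (qPoch q q (n - r) * qPoch q q (n + r + 1)))
      (G := fun r => (-1) ^ r * q ^ (r ^ 2) * (q ^ (n + 1 + r) - q ^ (n + 1 - r))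
        / (qPoch q q (n + 1 - r) * qPoch q q (n + 1 + r))) n (by simp)
      (by
        rintro r s rfl
        have e1 : r + s + 1 - r = s + 1 := by omega
        have e3 : r + s - r = s := by omega
        have e4 : r + s + r + 1 = 2 * r + s + 1 := by omega
        have e5 : r + s + 1 - (r + 1) = s := by omega
        have e6 : r + s + 1 + (r + 1) = (2 * r + s + 1) + 1 := by omega
        have e7 : r + s + 1 + r = 2 * r + s + 1 := by omega
        simp only [e1, e3, e4, e5, e6, e7, qPoch_self_succ q s,
          qPoch_self_succ q (2 * r + s + 1)]
        have := hP s; have := hP (2 * r + s + 1); have := h1 s; have := h1 (2 * r + s + 1)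
        field_simp
        ring)
      (by
        have e2 : n + 1 + (n + 1) = 2 * n + 2 := by omega
        simp only [e2, Nat.sub_self, qPoch_self_succ q (2 * n + 2), qPoch_zero]
        have := hP (2 * n + 2); have := h1 (2 * n + 2)
        field_simp
        ring)
    rw [ih, one_mul] at key
    have h3 : 1 - q ^ (2 * n + 2) = (1 - q ^ (n + 1)) * (1 + q ^ (n + 1)) := by ring
    have := hP n; have := hM n; have := h1 n; have := h2 n
    rw [h3] at key
    rw [qPoch_self_succ, qPoch_neg_self_succ]
    refine mul_left_cancel₀ (mul_ne_zero (h1 n) (h2 n)) (key.trans ?_)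
    field_simp

/-- The finite form of the Jacobi triple product. -/
theorem sum_finite_triple_product {a b : ℂ} (hab : ‖a * b‖ < 1) (n : ℕ) :
    ∑ r ∈ range (n + 1),
        (-1) ^ r * (a ^ r * (a * b) ^ r.choose 2 - b ^ (r + 1) * (a * b) ^ (r + 1).choose 2)
          / (qPoch (a * b) (a * b) (n - r) * qPoch (a * b) (a * b) (n + r + 1))
      = qPoch b (a * b) (n + 1) * qPoch a (a * b) n / qPoch (a * b) (a * b) (2 * n + 1) := by
  have hP := qPoch_ne_zero hab hab
  have h1 := one_sub_pow_succ_ne_zero hab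
  have hS := qPoch_self_succ (a * b)
  have ht : ∀ r : ℕ, (r + 1).choose 2 = r + r.choose 2 := fun r => by
    rw [Nat.choose_succ_succ' r 1, Nat.choose_one_right]
  induction n with
  | zero => simp [qPoch]
  | succ n ih =>
    have h0 := qPoch_zero (a * b) (a * b)
    have key := mul_sum_range_eq_of_telescope
      (c := (1 - (a * b) ^ (2 * n + 2)) * (1 - (a * b) ^ (2 * n + 3)))
      (d := (1 - b * (a * b) ^ (n + 1)) * (1 - a * (a * b) ^ n))
      (F' := fun r => (-1) ^ r *
        (a ^ r * (a * b) ^ r.choose 2 - b ^ (r + 1) * (a * b) ^ (r + 1).choose 2)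
          / (qPoch (a * b) (a * b) (n + 1 - r) * qPoch (a * b) (a * b) (n + 1 + r + 1)))
      (F := fun r => (-1) ^ r *
        (a ^ r * (a * b) ^ r.choose 2 - b ^ (r + 1) * (a * b) ^ (r + 1).choose 2)
          / (qPoch (a * b) (a * b) (n - r) * qPoch (a * b) (a * b) (n + r + 1)))
      -- The a-part and the b-part are formally exchanged by r ↦ -r, so they cancel at r = 0.
      (G := fun r => (-1) ^ r * (a * b) ^ r.choose 2 *
        (a ^ r * (-(a * b) ^ (n + 1 - r) * (1 - b * (a * b) ^ (n + 1))
            + (a * b) ^ (n + 1) * ((a * b) ^ (n + 1) - b))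
          - b ^ r * (-(a * b) ^ (n + 1 + r) * (1 - b * (a * b) ^ (n + 1))
            + (a * b) ^ (n + 1) * ((a * b) ^ (n + 1) - b)))
        / (qPoch (a * b) (a * b) (n + 1 - r) * qPoch (a * b) (a * b) (n + 1 + r))) n (by simp)
      (by
        rintro r s rfl
        have e1 : r + s + 1 - r = s + 1 := by omega
        have e3 : r + s - r = s := by omega
        have e4 : r + s + r + 1 = 2 * r + s + 1 := by omega
        have e5 : r + s + 1 - (r + 1) = s := by omega
        have e6 : r + s + 1 + (r + 1) = (2 * r + s + 1) + 1 := by omega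
        have e7 : r + s + 1 + r = 2 * r + s + 1 := by omega
        simp only [e1, e3, e4, e5, e6, e7, hS s, hS (2 * r + s + 1), ht]
        have := hP s; have := hP (2 * r + s + 1); have := h1 s; have := h1 (2 * r + s + 1)
        generalize qPoch (a * b) (a * b) s = A at *
        generalize qPoch (a * b) (a * b) (2 * r + s + 1) = B at *
        clear hS hP h1 ih
        -- Here `positivity` obtains nonzero denominators from the `≠ 0` hypotheses in context.
        rw [mul_div_assoc', mul_div_assoc', div_sub_div _ _ (by positivity) (by positivity),
          div_sub_div _ _ (by positivity) (by positivity),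
          div_eq_div_iff (by positivity) (by positivity)]
        ring)
      (by
        have e2 : n + 1 + (n + 1) = 2 * n + 2 := by omega
        simp only [e2, Nat.sub_self, hS (2 * n + 2), h0, ht, one_mul]
        have := hP (2 * n + 2); have := h1 (2 * n + 2)
        generalize qPoch (a * b) (a * b) (2 * n + 2) = B at *
        clear hS hP h1 ih
        rw [mul_div_assoc', div_add_div _ _ (by positivity) (by positivity),
          div_eq_zero_iff]
        left
        ring)
    rw [ih] at key
    have e : 2 * (n + 1) + 1 = (2 * n + 1) + 1 + 1 := by omega
    rw [e, hS, hS (2 * n + 1), qPoch_succ b, qPoch_succ a]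
    have := hP (2 * n + 1); have := h1 (2 * n + 1); have := h1 (2 * n + 1 + 1)
    refine mul_left_cancel₀ (mul_ne_zero (h1 (2 * n + 1)) (h1 (2 * n + 1 + 1))) (key.trans ?_)
    generalize qPoch (a * b) (a * b) (2 * n + 1) = B at *
    rw [mul_div_assoc', mul_div_assoc', div_eq_div_iff (by positivity) (by positivity)]
    ring

/-- A limiting case of the `q`-Vandermonde summation. -/
theorem sum_qVandermonde {q : ℂ} (hq : ‖q‖ < 1) (M c : ℕ) :
    ∑ t ∈ range (M + 1),
        q ^ (t * (t + c)) / (qPoch q q (M - t) * qPoch q q t * qPoch q q (t + c))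
      = 1 / (qPoch q q M * qPoch q q (M + c)) := by
  have hP := qPoch_ne_zero hq hq
  have h1 := one_sub_pow_succ_ne_zero hq
  have hS := qPoch_self_succ q
  have h0 := qPoch_zero q q
  -- The recursion goes from (n, c + 1) to (n + 1, c), which keeps M + c fixed, so the right-hand
  -- side only gains 1/(1 - q^(n+1)).
  induction M generalizing c with
  | zero => simp [h0]
  | succ n ih =>
    have key := mul_sum_range_eq_of_telescope (c := 1 - q ^ (n + 1)) (d := 1)
      (F' := fun t => q ^ (t * (t + c))
        / (qPoch q q (n + 1 - t) * qPoch q q t * qPoch q q (t + c)))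
      (F := fun t => q ^ (t * (t + (c + 1)))
        / (qPoch q q (n - t) * qPoch q q t * qPoch q q (t + (c + 1))))
      (G := fun t => -(q ^ (t * (t + c)) * (1 - q ^ t)
        / (qPoch q q (n + 1 - t) * qPoch q q t * qPoch q q (t + c)))) n (by simp)
      (by
        rintro r s rfl
        have e1 : r + s + 1 - r = s + 1 := by omega
        have e3 : r + s - r = s := by omega
        have e5 : r + s + 1 - (r + 1) = s := by omega
        have e6 : r + 1 + c = r + c + 1 := by omega
        simp only [e1, e3, e5, e6, ← add_assoc, hS s, hS (r + c), hS r]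
        have := hP s; have := hP r; have := hP (r + c); have := h1 s; have := h1 (r + c)
        have := h1 r
        field_simp
        ring)
      (by simp only [Nat.sub_self]; ring)
    rw [ih, one_mul] at key
    refine mul_left_cancel₀ (h1 n) (key.trans ?_)
    have := hP n; have := h1 n; have := hP (n + 1 + c)
    rw [hS n, show n + (c + 1) = n + 1 + c by omega]
    field_simp

/-! ### The iterated Bailey pair -/

/-- The `β`-sequence of the `m`-fold iterated Bailey pair over `β_L = 1 / (q²; q²)_L`. -/
noncomputable def baileyBeta (q : ℂ) : ℕ → ℕ → ℂ
  | 0, L => 1 / (qPoch q q L * qPoch (-q) q L)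
  | m + 1, L => ∑ r ∈ range (L + 1), q ^ (r ^ 2 + r) * baileyBeta q m r / qPoch q q (L - r)

/-- The `α`-sequence of the `m`-fold iterated Bailey pair, up to the factor `1 - q`. -/
noncomputable def baileyAlpha (q : ℂ) (m r : ℕ) : ℂ :=
  (-1) ^ r * q ^ (m * (r ^ 2 + r) + r ^ 2) * (1 - q ^ (2 * r + 1))

/-- After exchanging sums, put r = s + t: r² + r = (s² + s) + t(t + 2s + 1). The first part passes
from α at level m to level m + 1, the second is q-Vandermonde with c = 2s + 1. -/
theorem baileyBeta_eq_sum {q : ℂ} (hq : ‖q‖ < 1) (m L : ℕ) :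
    baileyBeta q m L = ∑ r ∈ range (L + 1),
      baileyAlpha q m r / (qPoch q q (L - r) * qPoch q q (L + r + 1)) := by
  induction m generalizing L with
  | zero =>
    rw [baileyBeta, ← sum_bailey_pair_base hq]
    simp [baileyAlpha]
  | succ m ih =>
    have hP := qPoch_ne_zero hq hq
    simp only [baileyBeta, ih, Finset.mul_sum, Finset.sum_div]
    rw [Finset.sum_comm' (t' := range (L + 1)) (s' := fun s => Finset.Ico s (L + 1))
      (by intro x y; simp only [Finset.mem_range, Finset.mem_Ico]; omega)]
    refine Finset.sum_congr rfl fun s hs => ?_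
    obtain ⟨M, rfl⟩ := Nat.exists_eq_add_of_le (Nat.lt_succ_iff.mp (Finset.mem_range.mp hs))
    rw [Finset.sum_Ico_eq_sum_range, show s + M + 1 - s = M + 1 by omega,
      show s + M - s = M by omega, show s + M + s + 1 = M + (2 * s + 1) by omega]
    have := sum_qVandermonde hq M (2 * s + 1)
    calc _ = baileyAlpha q (m + 1) s * ∑ t ∈ range (M + 1), q ^ (t * (t + (2 * s + 1)))
          / (qPoch q q (M - t) * qPoch q q t * qPoch q q (t + (2 * s + 1))) := by
          rw [Finset.mul_sum]
          refine Finset.sum_congr rfl fun t _ => ?_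
          rw [show s + M - (s + t) = M - t by omega, show s + t - s = t by omega,
            show s + t + s + 1 = t + (2 * s + 1) by omega, baileyAlpha, baileyAlpha]
          have := hP (M - t); have := hP t; have := hP (t + (2 * s + 1))
          field_simp
          ring
      _ = _ := by rw [this]; ring

/-! ### Infinite products and the Jacobi triple product -/

theorem tendsto_qPoch (a : ℂ) {q : ℂ} (hq : ‖q‖ < 1) :
    Tendsto (qPoch a q) atTop (𝓝 (qPochInf a q)) :=
  (multipliable_qPochInf a hq).tendsto_prod_tprod_nat

theorem qPochInf_ne_zero {a q : ℂ} (ha : ‖a‖ < 1) (hq : ‖q‖ < 1) : qPochInf a q ≠ 0 := by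
  have h : Summable fun j : ℕ => ‖-(a * q ^ j)‖ := by
    simpa [norm_mul, norm_pow] using
      (summable_geometric_of_lt_one (norm_nonneg q) hq).mul_left ‖a‖
  have := tprod_one_add_ne_zero_of_summable (f := fun j : ℕ => -(a * q ^ j))
    (fun j => by simpa [sub_eq_add_neg] using one_sub_mul_pow_ne_zero ha hq j) h
  simpa [qPochInf, sub_eq_add_neg] using this

theorem exists_norm_le_of_tendsto {u : ℕ → ℂ} {l : ℂ} (h : Tendsto u atTop (𝓝 l)) :
    ∃ C : ℝ, 0 ≤ C ∧ ∀ n, ‖u n‖ ≤ C := by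
  obtain ⟨C, hC⟩ := h.norm.bddAbove_range
  have hC' : ∀ n, ‖u n‖ ≤ C := fun n => hC ⟨n, rfl⟩
  exact ⟨C, (norm_nonneg _).trans (hC' 0), hC'⟩

theorem exists_norm_qPoch_le (a : ℂ) {q : ℂ} (hq : ‖q‖ < 1) :
    ∃ C : ℝ, 0 ≤ C ∧ ∀ n, ‖qPoch a q n‖ ≤ C :=
  exists_norm_le_of_tendsto (tendsto_qPoch a hq)

theorem exists_norm_qPoch_inv_le {a q : ℂ} (ha : ‖a‖ < 1) (hq : ‖q‖ < 1) :
    ∃ D : ℝ, 0 ≤ D ∧ ∀ n, ‖(qPoch a q n)⁻¹‖ ≤ D :=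
  exists_norm_le_of_tendsto ((tendsto_qPoch a hq).inv₀ (qPochInf_ne_zero ha hq))

theorem self_le_choose_two (n : ℕ) : n ≤ (n + 1).choose 2 := by
  rw [Nat.choose_succ_succ' n 1, Nat.choose_one_right]
  exact Nat.le_add_right _ _

theorem norm_pow_le_norm_pow {q : ℂ} (hq : ‖q‖ < 1) {m n : ℕ} (h : m ≤ n) :
    ‖q ^ n‖ ≤ ‖q‖ ^ m := by
  rw [norm_pow]
  exact pow_le_pow_of_le_one (norm_nonneg q) hq.le h

/-- The Jacobi triple product, with the terms of index `r` and `-r - 1` paired. -/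
theorem hasSum_triple_product {a b : ℂ} (ha : ‖a‖ < 1) (hb : ‖b‖ < 1) :
    HasSum (fun r : ℕ => (-1) ^ r *
        (a ^ r * (a * b) ^ r.choose 2 - b ^ (r + 1) * (a * b) ^ (r + 1).choose 2))
      (qPochInf b (a * b) * qPochInf a (a * b) * qPochInf (a * b) (a * b)) := by
  set Q := a * b with hQdef
  have hQ : ‖Q‖ < 1 := by
    rw [hQdef, norm_mul]; nlinarith [norm_nonneg a, norm_nonneg b]
  obtain ⟨D, hD0, hD⟩ := exists_norm_qPoch_inv_le hQ hQ
  set w : ℕ → ℂ := fun r => (-1) ^ r *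
    (a ^ r * Q ^ r.choose 2 - b ^ (r + 1) * Q ^ (r + 1).choose 2) with hw
  have hwb : ∀ r, ‖w r‖ ≤ ‖a‖ ^ r + ‖b‖ ^ r := fun r => by
    have h1 : ∀ n, ‖Q ^ n‖ ≤ 1 := fun n => by
      rw [norm_pow]; exact pow_le_one₀ (norm_nonneg _) hQ.le
    calc ‖w r‖ ≤ ‖a ^ r * Q ^ r.choose 2‖ + ‖b ^ (r + 1) * Q ^ (r + 1).choose 2‖ := by
          simp only [hw, norm_mul, norm_pow, norm_neg, norm_one, one_pow, one_mul]
          simpa using norm_sub_le (a ^ r * Q ^ r.choose 2) (b ^ (r + 1) * Q ^ (r + 1).choose 2)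
      _ ≤ ‖a‖ ^ r * 1 + ‖b‖ ^ r * 1 := by
          rw [norm_mul, norm_mul]
          gcongr
          · rw [norm_pow]
          · exact h1 _
          · exact norm_pow_le_norm_pow hb (Nat.le_succ r)
          · exact h1 _
      _ = _ := by ring
  have hgeom : Summable fun r : ℕ => ‖a‖ ^ r + ‖b‖ ^ r :=
    (summable_geometric_of_lt_one (norm_nonneg a) ha).add
      (summable_geometric_of_lt_one (norm_nonneg b) hb)
  have hsum : Summable w := Summable.of_norm_bounded hgeom hwb
  -- Let n → ∞ in the finite form, with a geometric majorant.
  have hlim := tendsto_tsum_of_dominated_convergence (𝓕 := atTop) (β := ℕ)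
    (f := fun n r : ℕ => if r ≤ n then w r * ((qPoch Q Q (n - r))⁻¹ * (qPoch Q Q (n + r + 1))⁻¹)
      else 0)
    (g := fun r => w r * ((qPochInf Q Q)⁻¹ * (qPochInf Q Q)⁻¹))
    (bound := fun r => (‖a‖ ^ r + ‖b‖ ^ r) * (D * D)) (hgeom.mul_right _)
    (fun r => by
      have hi := (tendsto_qPoch Q hQ).inv₀ (qPochInf_ne_zero hQ hQ)
      have h1 := hi.comp (tendsto_sub_atTop_nat r)
      have h2 := hi.comp (tendsto_add_atTop_nat (r + 1))
      refine ((h1.mul h2).const_mul (w r)).congr' ?_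
      filter_upwards [eventually_ge_atTop r] with n hn
      simp [hn, add_assoc])
    (Eventually.of_forall fun n r => by
      split_ifs
      · rw [norm_mul, norm_mul (qPoch Q Q (n - r))⁻¹]
        exact mul_le_mul (hwb r) (mul_le_mul (hD _) (hD _) (norm_nonneg _) hD0)
          (by positivity) (by positivity)
      · rw [norm_zero]; positivity)
  have hfin : ∀ n : ℕ, (∑' r, if r ≤ n then
      w r * ((qPoch Q Q (n - r))⁻¹ * (qPoch Q Q (n + r + 1))⁻¹) else 0)
      = qPoch b Q (n + 1) * qPoch a Q n / qPoch Q Q (2 * n + 1) := fun n => by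
    rw [← sum_finite_triple_product hQ n, tsum_eq_sum (s := range (n + 1))]
    · refine Finset.sum_congr rfl fun r hr => ?_
      rw [if_pos (Nat.lt_succ_iff.mp (Finset.mem_range.mp hr)), ← mul_inv, ← div_eq_mul_inv]
    · intro r hr
      rw [if_neg]
      simpa [Nat.lt_succ_iff] using hr
  simp only [hfin] at hlim
  have hlim2 : Tendsto (fun n => qPoch b Q (n + 1) * qPoch a Q n / qPoch Q Q (2 * n + 1)) atTop
      (𝓝 (qPochInf b Q * qPochInf a Q / qPochInf Q Q)) := by
    refine Tendsto.div (((tendsto_qPoch b hQ).comp (tendsto_add_atTop_nat 1)).mul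
      (tendsto_qPoch a hQ)) ((tendsto_qPoch Q hQ).comp ?_) (qPochInf_ne_zero hQ hQ)
    exact tendsto_atTop_mono (fun n => show n ≤ 2 * n + 1 by omega) tendsto_id
  have heq := tendsto_nhds_unique hlim hlim2
  rw [tsum_mul_right] at heq
  have hne := qPochInf_ne_zero hQ hQ
  have : ∑' r, w r = qPochInf b Q * qPochInf a Q * qPochInf Q Q := by
    field_simp at heq
    linear_combination heq
  exact this ▸ hsum.hasSum

/-! ### The outer sum over N_1 -/

/-- The terms of the `₁φ₁` series whose sum drives the last step of the Bailey chain. -/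
noncomputable def phiTerm (q : ℂ) (r t : ℕ) : ℂ :=
  q ^ ((t + 1).choose 2 + r * t) * qPoch (-q) q (r + t)
    * ((qPoch q q t)⁻¹ * (qPoch q q (t + 2 * r + 1))⁻¹)

theorem exists_norm_phiTerm_le {q : ℂ} (hq : ‖q‖ < 1) :
    ∃ C : ℝ, 0 ≤ C ∧ ∀ r t, ‖phiTerm q r t‖ ≤ C * ‖q‖ ^ t := by
  obtain ⟨C, hC0, hC⟩ := exists_norm_qPoch_le (-q) hq
  obtain ⟨D, hD0, hD⟩ := exists_norm_qPoch_inv_le hq hq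
  refine ⟨C * (D * D), by positivity, fun r t => ?_⟩
  calc ‖phiTerm q r t‖ ≤ ‖q‖ ^ t * C * (D * D) := by
        rw [phiTerm, norm_mul, norm_mul, norm_mul]
        gcongr
        · exact norm_pow_le_norm_pow hq ((self_le_choose_two t).trans (Nat.le_add_right _ _))
        · exact hC _
        · exact hD _
        · exact hD _
    _ = _ := by ring

theorem summable_phiTerm {q : ℂ} (hq : ‖q‖ < 1) (r : ℕ) : Summable (phiTerm q r) := by
  obtain ⟨C, -, hC⟩ := exists_norm_phiTerm_le hq
  exact Summable.of_norm_bounded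
    ((summable_geometric_of_lt_one (norm_nonneg q) hq).mul_left C) (hC r)

/-- Certificate that the sum over t is independent of r: `G` vanishes at 0 and tends to 0. -/
theorem phiTerm_succ_sub {q : ℂ} (hq : ‖q‖ < 1) (r t : ℕ) :
    let G : ℕ → ℂ := fun t => (1 - q ^ t) * (1 + (q ^ (r + 1) - q ^ (2 * r + 2)) * q ^ t)
      / (1 - q ^ (2 * r + 2) * q ^ t) * phiTerm q r t
    phiTerm q (r + 1) t - phiTerm q r t = G (t + 1) - G t := by
  intro G
  have hP := qPoch_ne_zero hq hq
  have h1 := one_sub_pow_succ_ne_zero hq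
  have ht : (t + 1 + 1).choose 2 = t + 1 + (t + 1).choose 2 := by
    rw [Nat.choose_succ_succ' (t + 1) 1, Nat.choose_one_right]
  have a1 : 1 - q ^ (2 * r + 2) * q ^ t ≠ 0 := by
    have := h1 (2 * r + 1 + t)
    rwa [show 2 * r + 1 + t + 1 = 2 * r + 2 + t by ring, pow_add] at this
  have a2 : 1 - q ^ (2 * r + 2) * q ^ (t + 1) ≠ 0 := by
    have := h1 (2 * r + 2 + t)
    rwa [show 2 * r + 2 + t + 1 = 2 * r + 2 + (t + 1) by ring, pow_add] at this
  have a3 := h1 t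
  have b1 : qPoch q q (t + 2 * r + 1 + 1)
      = qPoch q q (t + 2 * r + 1) * (1 - q ^ (2 * r + 2) * q ^ t) := by
    rw [qPoch_self_succ]; ring
  have b2 : qPoch q q (t + 2 * r + 1 + 1 + 1) = qPoch q q (t + 2 * r + 1)
      * (1 - q ^ (2 * r + 2) * q ^ t) * (1 - q ^ (2 * r + 2) * q ^ (t + 1)) := by
    rw [qPoch_self_succ, b1]; ring
  have b3 : qPoch (-q) q (r + t + 1) = qPoch (-q) q (r + t) * (1 + q ^ (r + t + 1)) :=
    qPoch_neg_self_succ q _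
  simp only [G, phiTerm, show t + 2 * (r + 1) + 1 = t + 2 * r + 1 + 1 + 1 by ring,
    show t + 1 + 2 * r + 1 = t + 2 * r + 1 + 1 by ring, show r + 1 + t = r + t + 1 by ring,
    ← add_assoc r t 1, b1, b2, b3, ht, qPoch_self_succ q t]
  have c1 := hP t
  have c2 := hP (t + 2 * r + 1)
  generalize qPoch q q t = A at *
  generalize qPoch q q (t + 2 * r + 1) = B at *
  generalize qPoch (-q) q (r + t) = E at *
  clear hP h1 b1 b2 b3 G ht
  generalize (t + 1).choose 2 = c at *
  simp only [← mul_inv]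
  simp only [← div_eq_mul_inv, div_mul_div_comm]
  rw [div_sub_div _ _ (by positivity) (by positivity),
    div_sub_div _ _ (by positivity) (by positivity),
    div_eq_div_iff (by positivity) (by positivity)]
  ring

theorem tsum_phiTerm_succ {q : ℂ} (hq : ‖q‖ < 1) (r : ℕ) :
    ∑' t, phiTerm q (r + 1) t = ∑' t, phiTerm q r t := by
  have hs := (summable_phiTerm hq (r + 1)).hasSum.sub (summable_phiTerm hq r).hasSum
  have hlim := hs.tendsto_sum_nat
  let G : ℕ → ℂ := fun t => (1 - q ^ t) * (1 + (q ^ (r + 1) - q ^ (2 * r + 2)) * q ^ t)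
    / (1 - q ^ (2 * r + 2) * q ^ t) * phiTerm q r t
  have hG : ∀ n, ∑ t ∈ range n, (phiTerm q (r + 1) t - phiTerm q r t) = G n - G 0 := fun n => by
    rw [← Finset.sum_range_sub G]
    exact Finset.sum_congr rfl fun t _ => phiTerm_succ_sub hq r t
  simp only [hG] at hlim
  have hpow : Tendsto (fun t : ℕ => q ^ t) atTop (𝓝 0) :=
    tendsto_pow_atTop_nhds_zero_of_norm_lt_one hq
  have hzero : Tendsto (fun t => G t - G 0) atTop (𝓝 0) := by
    have h1 := ((hpow.const_sub 1).mul
      ((hpow.const_mul (q ^ (r + 1) - q ^ (2 * r + 2))).const_add 1)).div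
      ((hpow.const_mul (q ^ (2 * r + 2))).const_sub 1) (by simp)
    simpa [G] using h1.mul (summable_phiTerm hq r).tendsto_atTop_zero
  exact sub_eq_zero.mp (tendsto_nhds_unique hlim hzero)

/-- The sum is constant in r, so it equals its limit as r → ∞, where the factor q^(rt) kills every
term but t = 0. -/
theorem hasSum_phiTerm {q : ℂ} (hq : ‖q‖ < 1) (r : ℕ) :
    HasSum (phiTerm q r) (qPochInf (-q) q / qPochInf q q) := by
  obtain ⟨C, -, hC⟩ := exists_norm_phiTerm_le hq
  have hconst : ∀ r, ∑' t, phiTerm q r t = ∑' t, phiTerm q 0 t := fun r => by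
    induction r with
    | zero => rfl
    | succ r ih => rw [tsum_phiTerm_succ hq, ih]
  have hlim := tendsto_tsum_of_dominated_convergence (𝓕 := atTop) (f := phiTerm q)
    (g := fun t => if t = 0 then qPochInf (-q) q / qPochInf q q else 0)
    ((summable_geometric_of_lt_one (norm_nonneg q) hq).mul_left C)
    (fun t => by
      have hi := (tendsto_qPoch q hq).inv₀ (qPochInf_ne_zero hq hq)
      have hden : Tendsto (fun r => (qPoch q q (t + 2 * r + 1))⁻¹) atTop
          (𝓝 (qPochInf q q)⁻¹) :=
        hi.comp (tendsto_atTop_mono (fun n => show n ≤ t + 2 * n + 1 by omega) tendsto_id)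
      have hnum : Tendsto (fun r => qPoch (-q) q (r + t)) atTop (𝓝 (qPochInf (-q) q)) :=
        (tendsto_qPoch (-q) hq).comp (tendsto_add_atTop_nat t)
      rcases Nat.eq_zero_or_pos t with rfl | ht
      · simpa [phiTerm, div_eq_mul_inv, qPoch_zero] using hnum.mul hden
      · have hpow : Tendsto (fun r : ℕ => q ^ ((t + 1).choose 2 + r * t)) atTop (𝓝 0) :=
          (tendsto_pow_atTop_nhds_zero_of_norm_lt_one hq).comp
            (tendsto_atTop_mono (fun n => show n ≤ (t + 1).choose 2 + n * t from
              (Nat.le_mul_of_pos_right n ht).trans (Nat.le_add_left _ _)) tendsto_id)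
        simpa [phiTerm, ht.ne'] using
          (hpow.mul hnum).mul (hden.const_mul (qPoch q q t)⁻¹))
    (Eventually.of_forall fun r t => hC r t)
  rw [tsum_ite_eq] at hlim
  have : ∑' t, phiTerm q r t = qPochInf (-q) q / qPochInf q q := by
    refine tendsto_nhds_unique ?_ hlim
    simp only [hconst]
    exact tendsto_const_nhds
  exact this ▸ (summable_phiTerm hq r).hasSum

theorem add_add_choose_two (r t : ℕ) :
    (r + t + 1).choose 2 = (r + 1).choose 2 + ((t + 1).choose 2 + r * t) := by
  induction t with
  | zero => simp
  | succ t ih =>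
    rw [Nat.choose_succ_succ' (r + (t + 1)) 1, Nat.choose_succ_succ' (t + 1) 1, ← add_assoc, ih]
    simp only [Nat.choose_one_right]
    ring

theorem norm_baileyAlpha_le {q : ℂ} (hq : ‖q‖ < 1) (m r : ℕ) : ‖baileyAlpha q m r‖ ≤ 2 := by
  have h : ∀ n, ‖q ^ n‖ ≤ 1 := fun n => by
    simpa using norm_pow_le_norm_pow hq (Nat.zero_le n)
  calc ‖baileyAlpha q m r‖ ≤ 1 * (1 + 1) := by
        rw [baileyAlpha, norm_mul, norm_mul]
        simp only [norm_pow (-1 : ℂ), norm_neg, norm_one, one_pow, one_mul]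
        refine (mul_le_mul (h _) ((norm_sub_le _ _).trans ?_) (norm_nonneg _)
          zero_le_one).trans (one_mul _).le
        rw [norm_one]
        linarith [h (2 * r + 1)]
    _ = 2 := by norm_num

/-- Matches the α-side with the triple product for a = q^(2m+2), b = q. -/
theorem baileyAlpha_mul_pow_choose (q : ℂ) (m r : ℕ) :
    baileyAlpha q m r * q ^ (r + 1).choose 2 = (-1) ^ r *
      ((q ^ (2 * m + 2)) ^ r * (q ^ (2 * m + 2) * q) ^ r.choose 2
        - q ^ (r + 1) * (q ^ (2 * m + 2) * q) ^ (r + 1).choose 2) := by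
  have h1 : (r + 1).choose 2 = r + r.choose 2 := by
    rw [Nat.choose_succ_succ' r 1, Nat.choose_one_right]
  have h2 : r ^ 2 = 2 * r.choose 2 + r := by
    rw [Nat.choose_two_right, Nat.two_mul_div_two_of_even (Nat.even_mul_pred_self r)]
    cases r <;> simp; ring
  rw [baileyAlpha, h1, h2]
  ring

/-- The last step of the Bailey chain: the sum of `q^{N(N+1)/2} (-q; q)_N β_N`. -/
theorem hasSum_baileyBeta {q : ℂ} (hq : ‖q‖ < 1) (m : ℕ) :
    HasSum (fun N : ℕ => q ^ (N + 1).choose 2 * qPoch (-q) q N * baileyBeta q m N)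
      (qPochInf (-q) q
          * (qPochInf q (q ^ (2 * m + 3)) * qPochInf (q ^ (2 * m + 2)) (q ^ (2 * m + 3))
              * qPochInf (q ^ (2 * m + 3)) (q ^ (2 * m + 3)))
        / qPochInf q q) := by
  obtain ⟨C, hC0, hC⟩ := exists_norm_phiTerm_le hq
  -- With N = r + t, summing over t first gives the product side, and summing along antidiagonals
  -- gives the β-side.
  set F : ℕ × ℕ → ℂ := fun p =>
    baileyAlpha q m p.1 * q ^ (p.1 + 1).choose 2 * phiTerm q p.1 p.2 with hF
  have hgeom := summable_geometric_of_lt_one (norm_nonneg q) hq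
  have hFs : Summable F := by
    refine Summable.of_norm_bounded (g := fun p : ℕ × ℕ => 2 * C * (‖q‖ ^ p.1 * ‖q‖ ^ p.2))
      ((hgeom.mul_of_nonneg hgeom (fun _ => by positivity) fun _ => by positivity).mul_left _)
      fun p => ?_
    calc ‖F p‖ ≤ 2 * ‖q‖ ^ p.1 * (C * ‖q‖ ^ p.2) := by
          rw [hF, norm_mul, norm_mul]
          gcongr
          · exact norm_baileyAlpha_le hq m _
          · exact norm_pow_le_norm_pow hq (self_le_choose_two _)
          · exact hC _ _
      _ = _ := by ring
  have hFsum : HasSum F (qPochInf (-q) q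
          * (qPochInf q (q ^ (2 * m + 3)) * qPochInf (q ^ (2 * m + 2)) (q ^ (2 * m + 3))
              * qPochInf (q ^ (2 * m + 3)) (q ^ (2 * m + 3)))
        / qPochInf q q) := by
    have h1 := hFs.hasSum.prod_fiberwise fun r => (hasSum_phiTerm hq r).mul_left
      (baileyAlpha q m r * q ^ (r + 1).choose 2)
    have hz : ‖q ^ (2 * m + 2)‖ < 1 := by
      rw [norm_pow]; exact pow_lt_one₀ (norm_nonneg q) hq (by omega)
    have h2 := (hasSum_triple_product hz hq).mul_right (qPochInf (-q) q / qPochInf q q)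
    simp only [← baileyAlpha_mul_pow_choose] at h2
    have h3 := h1.unique h2
    rw [← pow_succ] at h3
    convert hFs.hasSum using 1
    rw [h3]
    ring
  rw [← Finset.HasAntidiagonal.sigmaAntidiagonalEquivProd.hasSum_iff] at hFsum
  have h := hFsum.sigma fun N => hasSum_fintype _
  convert h using 1
  funext N
  rw [Finset.sum_coe_sort_eq_attach]
  simp only [Function.comp_apply, Finset.HasAntidiagonal.sigmaAntidiagonalEquivProd_apply]
  rw [Finset.sum_attach (antidiagonal N) F, Finset.Nat.sum_antidiagonal_eq_sum_range_succ_mk,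
    baileyBeta_eq_sum hq, Finset.mul_sum]
  refine Finset.sum_congr rfl fun r hr => ?_
  obtain ⟨t, rfl⟩ := Nat.exists_eq_add_of_le (Nat.lt_succ_iff.mp (Finset.mem_range.mp hr))
  simp only [hF, phiTerm, Nat.add_sub_cancel_left]
  rw [add_add_choose_two, pow_add, show r + t + r + 1 = t + 2 * r + 1 by ring]
  field_simp

/-! ### Unfolding the iterated sum into a multisum -/

/-- The terms of the iterated sum `baileyBeta q m L`, extended by zero to all `N : Fin m → ℕ`. -/
noncomputable def chainTerm (q : ℂ) : (m : ℕ) → ℕ → (Fin m → ℕ) → ℂ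
  | 0, L, _ => 1 / (qPoch q q L * qPoch (-q) q L)
  | m + 1, L, N => if N 0 ≤ L then
      q ^ (N 0 ^ 2 + N 0) * chainTerm q m (N 0) (Fin.tail N) / qPoch q q (L - N 0) else 0

theorem summable_prod_pow {x : ℝ} (hx0 : 0 ≤ x) (hx1 : x < 1) (m : ℕ) :
    Summable fun N : Fin m → ℕ => ∏ i, x ^ N i := by
  induction m with
  | zero => exact (hasSum_fintype _).summable
  | succ m ih =>
    rw [← (Fin.consEquiv fun _ : Fin (m + 1) => ℕ).summable_iff]
    refine ((summable_geometric_of_lt_one hx0 hx1).mul_of_nonneg ih (fun _ => by positivity)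
      fun _ => by positivity).congr fun p => ?_
    simp [Fin.prod_univ_succ, Fin.consEquiv]

/-- Uniformity in `L` is essential, since the recursion replaces `L` by `N 0`; the factor q^(N 0² +
N 0) supplies the new power of ‖q‖. -/
theorem exists_norm_chainTerm_le {q : ℂ} (hq : ‖q‖ < 1) (m : ℕ) :
    ∃ C : ℝ, 0 ≤ C ∧ ∀ L N, ‖chainTerm q m L N‖ ≤ C * ∏ i, ‖q‖ ^ N i := by
  obtain ⟨D, hD0, hD⟩ := exists_norm_qPoch_inv_le hq hq
  obtain ⟨E, hE0, hE⟩ := exists_norm_qPoch_inv_le (a := -q) (by simpa using hq) hq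
  induction m with
  | zero =>
    refine ⟨D * E, by positivity, fun L N => ?_⟩
    rw [chainTerm, one_div, mul_inv, norm_mul]
    simpa using mul_le_mul (hD L) (hE L) (norm_nonneg _) hD0
  | succ m ih =>
    obtain ⟨C, hC0, hC⟩ := ih
    refine ⟨C * D, by positivity, fun L N => ?_⟩
    rw [chainTerm]
    split_ifs
    · rw [div_eq_mul_inv, norm_mul, norm_mul, Fin.prod_univ_succ]
      calc _ ≤ ‖q‖ ^ N 0 * (C * ∏ i, ‖q‖ ^ Fin.tail N i) * D := by
            refine mul_le_mul (mul_le_mul (norm_pow_le_norm_pow hq (Nat.le_add_left _ _))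
              (hC _ _) (norm_nonneg _) (by positivity)) (hD _) (norm_nonneg _) (by positivity)
        _ = _ := by simp only [Fin.tail]; ring
    · rw [norm_zero]; positivity

theorem hasSum_chainTerm {q : ℂ} (hq : ‖q‖ < 1) (m L : ℕ) :
    HasSum (chainTerm q m L) (baileyBeta q m L) := by
  induction m generalizing L with
  | zero => exact hasSum_unique (chainTerm q 0 L)
  | succ m ih =>
    obtain ⟨C, -, hC⟩ := exists_norm_chainTerm_le hq (m + 1)
    have hs : Summable (chainTerm q (m + 1) L) := Summable.of_norm_bounded
      ((summable_prod_pow (norm_nonneg q) hq (m + 1)).mul_left C) (hC L)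
    have h := (Fin.consEquiv fun _ : Fin (m + 1) => ℕ).hasSum_iff.mpr hs.hasSum
    have h1 := h.prod_fiberwise (g := fun n => if n ≤ L then
        q ^ (n ^ 2 + n) * baileyBeta q m n / qPoch q q (L - n) else 0) fun n => by
      simp only [Function.comp_def, Fin.consEquiv, Equiv.coe_fn_mk, chainTerm, Fin.cons_zero,
        Fin.tail_cons]
      split_ifs
      · exact ((ih n).mul_left _).div_const _
      · exact hasSum_zero
    have h2 := hasSum_sum_of_ne_finset_zero (L := .unconditional ℕ)
      (s := range (L + 1)) (f := fun n => if n ≤ L then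
        q ^ (n ^ 2 + n) * baileyBeta q m n / qPoch q q (L - n) else 0) fun n hn => by
      rw [if_neg]
      simpa [Nat.lt_succ_iff] using hn
    have h3 := h1.unique h2
    convert hs.hasSum using 1
    rw [h3, baileyBeta]
    refine Finset.sum_congr rfl fun r hr => ?_
    rw [if_pos (Nat.lt_succ_iff.mp (Finset.mem_range.mp hr))]

/-- Lets sums over all tuples, which can be peeled one coordinate at a time, be restricted to
decreasing sequences. -/
theorem antitone_of_chainTerm_ne_zero {q : ℂ} {m : ℕ} {v : Fin (m + 1) → ℕ}
    (h : chainTerm q m (v 0) (Fin.tail v) ≠ 0) : Antitone v := by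
  rw [Fin.antitone_iff_succ_le]
  induction m with
  | zero => exact fun i => i.elim0
  | succ m ih =>
    rw [chainTerm] at h
    split_ifs at h with h0
    · have ht : chainTerm q m (Fin.tail v 0) (Fin.tail (Fin.tail v)) ≠ 0 := by
        rintro h'
        exact h (by rw [h', mul_zero, zero_div])
      intro i
      refine Fin.cases h0 (fun j => ?_) i
      exact ih ht j
    · exact absurd rfl h

theorem chainTerm_of_antitone (q : ℂ) {m : ℕ} {v : Fin (m + 1) → ℕ} (hv : Antitone v) :
    chainTerm q m (v 0) (Fin.tail v) = q ^ (∑ i : Fin m, (v i.succ ^ 2 + v i.succ))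
      / ((∏ i : Fin m, qPoch q q (v i.castSucc - v i.succ)) * qPoch q q (v (Fin.last m))
        * qPoch (-q) q (v (Fin.last m))) := by
  induction m with
  | zero => simp [chainTerm]
  | succ m ih =>
    have ht : Antitone (Fin.tail v) := fun i j hij => hv (Fin.succ_le_succ_iff.mpr hij)
    rw [chainTerm, if_pos (show Fin.tail v 0 ≤ v 0 from hv (Fin.zero_le _)), ih ht, Fin.sum_univ_succ,
      Fin.prod_univ_succ]
    simp only [Fin.tail, Fin.succ_castSucc, Fin.succ_last, Fin.castSucc_zero]
    rw [mul_div_assoc', div_div, mul_comm (_ * _ * _), ← pow_add]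
    simp only [mul_assoc]

theorem hasSum_pow_mul_chainTerm {q : ℂ} (hq : ‖q‖ < 1) (m : ℕ) :
    HasSum (fun N : Fin (m + 1) → ℕ => q ^ (N 0 + 1).choose 2 * qPoch (-q) q (N 0)
        * chainTerm q m (N 0) (Fin.tail N))
      (qPochInf (-q) q
          * (qPochInf q (q ^ (2 * m + 3)) * qPochInf (q ^ (2 * m + 2)) (q ^ (2 * m + 3))
              * qPochInf (q ^ (2 * m + 3)) (q ^ (2 * m + 3)))
        / qPochInf q q) := by
  obtain ⟨C, hC0, hC⟩ := exists_norm_chainTerm_le hq m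
  obtain ⟨D, hD0, hD⟩ := exists_norm_qPoch_le (-q) hq
  have hs : Summable fun N : Fin (m + 1) → ℕ => q ^ (N 0 + 1).choose 2 * qPoch (-q) q (N 0)
      * chainTerm q m (N 0) (Fin.tail N) := by
    refine Summable.of_norm_bounded
      ((summable_prod_pow (norm_nonneg q) hq (m + 1)).mul_left (C * D)) fun N => ?_
    rw [norm_mul, norm_mul, Fin.prod_univ_succ]
    calc _ ≤ ‖q‖ ^ N 0 * D * (C * ∏ i, ‖q‖ ^ Fin.tail N i) := by
          refine mul_le_mul (mul_le_mul (norm_pow_le_norm_pow hq (self_le_choose_two _))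
            (hD _) (norm_nonneg _) (by positivity)) (hC _ _) (norm_nonneg _) (by positivity)
      _ = _ := by simp only [Fin.tail]; ring
  have h := ((Fin.consEquiv fun _ : Fin (m + 1) => ℕ).hasSum_iff.mpr hs.hasSum).prod_fiberwise
    (g := fun n => q ^ (n + 1).choose 2 * qPoch (-q) q n * baileyBeta q m n) fun n => by
      simp only [Function.comp_def, Fin.consEquiv, Equiv.coe_fn_mk, Fin.cons_zero, Fin.tail_cons]
      exact (hasSum_chainTerm hq m n).mul_left _
  rw [← h.unique (hasSum_baileyBeta hq m)]
  exact hs.hasSum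

/-! ### Return to decreasing sequences -/

theorem DecSeq.entry_succ {r : ℕ} (N : DecSeq r) (i : Fin r) : N.entry (i + 1) = N.1 i := by
  rw [DecSeq.entry, dif_pos ⟨by omega, by omega⟩]
  rfl

theorem multisumTerm_eq (m : ℕ) (q : ℂ) (N : DecSeq (m + 1)) :
    multisumTerm (m + 2) q N = q ^ (N.1 0 + 1).choose 2 * qPoch (-q) q (N.1 0)
      * chainTerm q m (N.1 0) (Fin.tail N.1) := by
  have hsum : ∀ g : ℕ → ℕ, ∑ i ∈ Icc 2 (m + 1), g i = ∑ i : Fin m, g (i + 1 + 1) := fun g => by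
    rw [← Finset.Ico_add_one_right_eq_Icc, Finset.sum_Ico_eq_sum_range,
      show m + 1 + 1 - 2 = m by omega, Finset.sum_range]
    exact Finset.sum_congr rfl fun i _ => by congr 1; ring
  have hprod : ∀ g : ℕ → ℂ, ∏ i ∈ Icc 1 m, g i = ∏ i : Fin m, g (i + 1) := fun g => by
    rw [← Finset.Ico_add_one_right_eq_Icc, Finset.prod_Ico_eq_prod_range,
      Nat.add_sub_cancel, Finset.prod_range]
    exact Finset.prod_congr rfl fun i _ => by congr 1; ring
  have h1 : N.entry 1 = N.1 0 := N.entry_succ 0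
  have hl : N.entry (m + 1) = N.1 (Fin.last m) := N.entry_succ (Fin.last m)
  have hs : ∀ i : Fin m, N.entry (i + 1 + 1) = N.1 i.succ := fun i => N.entry_succ i.succ
  have hc : ∀ i : Fin m, N.entry (i + 1) = N.1 i.castSucc := fun i => N.entry_succ i.castSucc
  rw [chainTerm_of_antitone q N.2, multisumTerm]
  simp only [show m + 2 - 1 = m + 1 from rfl, show m + 2 - 2 = m from rfl, hsum, hprod, hs, hc,
    h1, hl, Finset.sum_add_distrib]
  rw [Nat.choose_two_right, Nat.add_sub_cancel, mul_comm (N.1 0 + 1), add_assoc, pow_add,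
    mul_div_assoc']
  congr 1
  ring

/-- Over ℂ, `HasSum` is unconditional and therefore absolute convergence. -/
theorem theorem2p2 (k : ℕ) (hk : 2 ≤ k) (q : ℂ) (hq : ‖q‖ < 1) :
    HasSum (fun N : DecSeq (k - 1) => multisumTerm k q N)
      (qPochInf (-q) q
          * (qPochInf q (q ^ (2 * k - 1)) * qPochInf (q ^ (2 * k - 2)) (q ^ (2 * k - 1))
              * qPochInf (q ^ (2 * k - 1)) (q ^ (2 * k - 1)))
        / qPochInf q q) := by
  obtain ⟨m, rfl⟩ := Nat.exists_eq_add_of_le' hk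
  have h := hasSum_pow_mul_chainTerm hq m
  rw [← Subtype.val_injective (p := fun N : Fin (m + 1) → ℕ => Antitone N) |>.hasSum_iff] at h
  · rw [show 2 * (m + 2) - 1 = 2 * m + 3 by omega, show 2 * (m + 2) - 2 = 2 * m + 2 by omega]
    exact (funext (multisumTerm_eq m q) : multisumTerm (m + 2) q = _) ▸ h
  · intro N hN
    by_contra hne
    exact hN ⟨⟨N, antitone_of_chainTerm_ne_zero (right_ne_zero_of_mul hne)⟩, rfl⟩
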